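/- (Reachability problem.) Let $d\ge 4$ be fixed. A state is a positive semidefinite matrix $\rho\in M_d(\mathbb C)$ with $\operatorname{tr}\rho=1$. For a set $\mathcal F$ of linear maps $M_d(\mathbb C)\to M_d(\mathbb C)$, let $\mathcal F^*$ be the semigroup of all finite compositions of elements of $\mathcal F$. An input consists of two states $\rho,\sigma\in M_d(\mathbb C)$ with entries in $\mathbb Q(i)$ and a description of a finite set $\mathcal F$ of completely positive trace preserving maps on $M_d(\mathbb C)$ that contains the identity, each map $\phi(X)=\sum_j K_jXK_j^\dagger$ being described by a finite list of Kraus operators $K_j$ with entries in $\mathbb Q(i)$. It is undecidable whether there exists $\phi\in\mathcal F^*$ such that $\phi(\rho)=\sigma$: no algorithm halts with the correct answer on every such input. -/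

import Mathlib

open scoped ComplexOrder

/-! ### Quantum states and channels on `ℂ^d` -/

/-- The linear maps `M_d(ℂ) → M_d(ℂ)`; multiplication is composition. -/
abbrev SuperOp (d : ℕ) : Type :=
  Module.End ℂ (Matrix (Fin d) (Fin d) ℂ)

/-- A state: a positive semidefinite matrix of trace one. -/
def IsState {d : ℕ} (ρ : Matrix (Fin d) (Fin d) ℂ) : Prop :=
  ρ.PosSemidef ∧ ρ.trace = 1

/-- The map `Φ ⊗ id` on `M_d(ℂ) ⊗ M_n(ℂ)`: apply `Φ` to each of the `n × n` blocks. -/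
def SuperOp.ampliate {d : ℕ} (Φ : SuperOp d) (n : ℕ)
    (X : Matrix (Fin d × Fin n) (Fin d × Fin n) ℂ) :
    Matrix (Fin d × Fin n) (Fin d × Fin n) ℂ :=
  Matrix.of fun p q =>
    Φ (Matrix.of fun a b => X (a, p.2) (b, q.2)) p.1 q.1

/-- Completely positive: `Φ ⊗ id_n` preserves positive semidefiniteness for all `n`. -/
def SuperOp.IsCompletelyPositive {d : ℕ} (Φ : SuperOp d) : Prop :=
  ∀ (n : ℕ) (X : Matrix (Fin d × Fin n) (Fin d × Fin n) ℂ),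
    X.PosSemidef → (Φ.ampliate n X).PosSemidef

def SuperOp.IsTracePreserving {d : ℕ} (Φ : SuperOp d) : Prop :=
  ∀ X : Matrix (Fin d) (Fin d) ℂ, (Φ X).trace = X.trace

/-- Completely positive trace preserving maps (quantum channels). -/
def SuperOp.IsCPTP {d : ℕ} (Φ : SuperOp d) : Prop :=
  Φ.IsCompletelyPositive ∧ Φ.IsTracePreserving

/-- The map `X ↦ K X K†`. -/
noncomputable def conjOp {d : ℕ} (K : Matrix (Fin d) (Fin d) ℂ) : SuperOp d :=
  LinearMap.mulLeft ℂ K * LinearMap.mulRight ℂ K.conjTranspose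

theorem conjOp_apply {d : ℕ} (K X : Matrix (Fin d) (Fin d) ℂ) :
    conjOp K X = K * X * K.conjTranspose := by
  simp [conjOp, Matrix.mul_assoc]

/-- The semigroup `F*` of all finite compositions of elements of `F`. -/
abbrev generatedSemigroup {d : ℕ} (F : Set (SuperOp d)) : Subsemigroup (SuperOp d) :=
  Subsemigroup.closure F

/-- The state `σ` can be reached from `ρ` by an element of `F*`. -/
def Reaches {d : ℕ} (F : Set (SuperOp d)) (ρ σ : Matrix (Fin d) (Fin d) ℂ) : Prop :=
  ∃ φ ∈ generatedSemigroup F, φ ρ = σ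

/-! ### Finite descriptions -/

/-- A description of a Gaussian rational: `(a, b, n)` stands for `(a + b i) / (n + 1)`. -/
abbrev ScalarCode : Type := ℤ × ℤ × ℕ

noncomputable def ScalarCode.eval (z : ScalarCode) : ℂ :=
  ((z.1 : ℂ) + (z.2.1 : ℂ) * Complex.I) / ((z.2.2 : ℂ) + 1)

/-- A description of a `d × d` matrix over `ℚ(i)`. -/
abbrev MatrixCode (d : ℕ) : Type := Fin d → Fin d → ScalarCode

noncomputable def MatrixCode.eval {d : ℕ} (M : MatrixCode d) :
    Matrix (Fin d) (Fin d) ℂ :=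
  Matrix.of fun i j => ScalarCode.eval (M i j)

/-- A description of a completely positive map: the list of its Kraus operators. -/
abbrev ChannelCode (d : ℕ) : Type := List (MatrixCode d)

/-- The map `X ↦ ∑ K, K X K†` with the listed Kraus operators `K`. -/
noncomputable def ChannelCode.eval {d : ℕ} (c : ChannelCode d) : SuperOp d :=
  (c.map fun K => conjOp (MatrixCode.eval K)).sum

/-- A description of a finite set `F` of maps. -/
abbrev OpSetCode (d : ℕ) : Type := List (ChannelCode d)

def OpSetCode.eval {d : ℕ} (L : OpSetCode d) : Set (SuperOp d) :=
  {Φ | ∃ c ∈ L, ChannelCode.eval c = Φ}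

/-- An input of the reachability problem: `(ρ, σ, F)`. -/
abbrev ReachInput (d : ℕ) : Type := MatrixCode d × MatrixCode d × OpSetCode d

/-- Meaningful inputs: `ρ` and `σ` are states, and `F` consists of CPTP maps and contains
the identity. -/
def ReachInput.Valid {d : ℕ} (x : ReachInput d) : Prop :=
  IsState (MatrixCode.eval x.1) ∧ IsState (MatrixCode.eval x.2.1) ∧
    (∀ Φ ∈ OpSetCode.eval x.2.2, Φ.IsCPTP) ∧ 1 ∈ OpSetCode.eval x.2.2

/-- The question: is there `φ ∈ F*` with `φ(ρ) = σ`? -/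
def ReachInput.Yes {d : ℕ} (x : ReachInput d) : Prop :=
  Reaches (OpSetCode.eval x.2.2) (MatrixCode.eval x.1) (MatrixCode.eval x.2.1)

/-- An algorithm (a partial recursive function) decides the question `yes` on the inputs
that satisfy `valid`: on each of these it halts with the right answer.
Nothing is asked of it on other inputs. -/
def DecidableOn {α : Type} [Primcodable α] (valid yes : α → Prop) : Prop :=
  ∃ f : α →. Bool, Partrec f ∧ ∀ x, valid x → ∃ b ∈ f x, (b = true ↔ yes x)

/-!
The halting problem reduces to reachability in three stages.

*From machines to word equations.* A single Turing machine has undecidable halting on the words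
`P bᵐ` (`exists_tm0_undecidable`: Mathlib's compilation of partial recursive functions, applied to a
universal function that reads `m` from the input `2 ^ m`, whose binary numeral is uniform in `m`).
A configuration is written as a circular word with one letter `mark`, and the machine is simulated by
a queue system: a rule `(x, y)` turns the queue `x s` into `s y`. Along a run with the rules
`(xᵢ, yᵢ)` from `A` to `T` the word equation `A y₁ ⋯ yₙ = x₁ ⋯ xₙ T` holds. Conversely every solution
of this equation is a run (`reaches_of_solvesQueue`), because the queue always contains `mark` and
`mark` can only be the last letter of a left-hand side, so that no rule asks for letters that are not
there yet. Hence solvability of the equation is undecidable for fixed rules and a start word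
`bᵐ Q` (`exists_queue_undecidable`), also over a binary alphabet.

*From words to unitary matrices.* The unitary matrices `diag ((3 + 4 i) / 5, 1)` and
`!![3, 4; -4, 3] / 5` satisfy no relation between positive words, even up to a scalar
(`eq_of_proportional_wordUnitary`). Multiplied by `5` and reduced modulo the Gaussian prime `2 - i`
they become rank one matrices whose products do not vanish, and the column space of such a product
determines the first letter of the word, which can then be cancelled.

*From matrices to channels.* A queue `w` is stored as the pure state of the vector of its unitary
`U w` in `ℂ^2 ⊗ ℂ^2 ⊆ ℂ^d`. The rule `(x, y)` is the unitary channel induced by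
`A ↦ (U x)⁻¹ A (U y)`. It is applicable to every state, but `T` can be reached from `A` exactly if
`A y₁ ⋯ yₙ = x₁ ⋯ xₙ T` for some rules, since a pure state determines its vector up to a phase
(`reaches_iff_exists_solvesQueue`). Only the initial state depends on `m`. Its entries are geometric
sequences in `m`, as the matrix of the letter `b` is diagonal, so it is computed by integer
arithmetic (`exists_computable_matrixState`).
-/

open Turing

/-! ### A Turing machine with undecidable halting on words `P bᵐ` -/

theorem trNat_two_pow (m : ℕ) :
    PartrecToTM2.trNat (2 ^ m) =
      List.replicate m PartrecToTM2.Γ'.bit0 ++ [PartrecToTM2.Γ'.bit1] := by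
  have key : ∀ m : ℕ, ∃ p : PosNum, ((2 ^ m : ℕ) : Num) = Num.pos p ∧
      PartrecToTM2.trPosNum p =
        List.replicate m PartrecToTM2.Γ'.bit0 ++ [PartrecToTM2.Γ'.bit1] := by
    intro m
    induction m with
    | zero => exact ⟨1, by simp; rfl, rfl⟩
    | succ m ih =>
      obtain ⟨p, hp, h⟩ := ih
      refine ⟨p.bit0, ?_, ?_⟩
      · have : ((2 ^ (m + 1) : ℕ) : Num) = ((2 ^ m : ℕ) : Num) + ((2 ^ m : ℕ) : Num) := by
          rw [← Nat.cast_add]; congr 1; ring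
        rw [this, hp]
        exact (Num.bit0_of_bit0 (Num.pos p))
      · simp [PartrecToTM2.trPosNum, h, List.replicate_succ]
  obtain ⟨p, hp, h⟩ := key m
  rw [PartrecToTM2.trNat, hp, PartrecToTM2.trNum, h]

/-- A `ToPartrec.Code` program halts if and only if its compilation to a stack machine does. -/
theorem tm2_eval_dom_iff (c : ToPartrec.Code) (v : List ℕ) :
    (@TM2.eval PartrecToTM2.K' (fun _ => PartrecToTM2.Γ') PartrecToTM2.Λ' (Option PartrecToTM2.Γ')
      ⟨PartrecToTM2.trNormal c PartrecToTM2.Cont'.halt⟩ _ _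
      PartrecToTM2.tr PartrecToTM2.K'.main (PartrecToTM2.trList v)).Dom ↔ (c.eval v).Dom := by
  have h := PartrecToTM2.tr_eval c v
  have hi : @TM2.init PartrecToTM2.K' (fun _ => PartrecToTM2.Γ') PartrecToTM2.Λ'
      (Option PartrecToTM2.Γ') ⟨PartrecToTM2.trNormal c PartrecToTM2.Cont'.halt⟩ _ _
      PartrecToTM2.K'.main (PartrecToTM2.trList v) = PartrecToTM2.init c v := by
    simp only [TM2.init, PartrecToTM2.init]
    congr 1
    funext k
    cases k <;> simp [Function.update]
  unfold TM2.eval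
  rw [hi, h]
  rfl

/-- A partial recursive function on `ℕ` is computed by a Turing machine with finitely many symbols
and states that receives `2 ^ m` as a fixed word followed by `m` copies of one symbol. -/
theorem exists_tm0_halts_iff (f : ℕ →. ℕ) (hf : Partrec f) :
    ∃ (Γ Λ : Type) (_ : Inhabited Γ) (_ : Inhabited Λ) (_ : Finite Γ)
      (M : TM0.Machine Γ Λ) (S : Finset Λ) (P : List Γ) (b : Γ), TM0.Supports M S ∧
      ∀ m, (TM0.eval M (P ++ List.replicate m b)).Dom ↔ (f (2 ^ m)).Dom := by
  classical
  obtain ⟨c, hc⟩ := ToPartrec.Code.exists_code (Nat.Partrec'.part_iff₁.2 hf)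
  let _ : Inhabited PartrecToTM2.Λ' := ⟨PartrecToTM2.trNormal c PartrecToTM2.Cont'.halt⟩
  let M₂ := PartrecToTM2.tr
  let M₁ := TM2to1.tr M₂
  let G : PartrecToTM2.Γ' → Bool → TM2to1.Γ' PartrecToTM2.K' (fun _ => PartrecToTM2.Γ') :=
    fun a t => (t, Function.update (fun _ => none) PartrecToTM2.K'.main (some a))
  refine ⟨TM2to1.Γ' PartrecToTM2.K' (fun _ => PartrecToTM2.Γ'), TM1to0.Λ' M₁, inferInstance,
    inferInstance, ?_, TM1to0.tr M₁, TM1to0.trStmts M₁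
      (TM2to1.trSupp M₂ (PartrecToTM2.codeSupp c PartrecToTM2.Cont'.halt)),
    [G .cons true, G .bit1 false], G .bit0 false, ?_, ?_⟩
  · have : Finite PartrecToTM2.K' :=
      Finite.of_surjective ![PartrecToTM2.K'.main, .rev, .aux, .stack] fun k => by
        cases k
        exacts [⟨0, rfl⟩, ⟨1, rfl⟩, ⟨2, rfl⟩, ⟨3, rfl⟩]
    unfold TM2to1.Γ'
    infer_instance
  · exact TM1to0.tr_supports _ (TM2to1.tr_supports _ (PartrecToTM2.tr_supports _ _))
  · intro m
    have h0 : [G .cons true, G .bit1 false] ++ List.replicate m (G .bit0 false) =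
        TM2to1.trInit PartrecToTM2.K'.main (PartrecToTM2.trList [2 ^ m]) := by
      have hl : (PartrecToTM2.trList [2 ^ m]).reverse = PartrecToTM2.Γ'.cons ::
          PartrecToTM2.Γ'.bit1 :: List.replicate m PartrecToTM2.Γ'.bit0 := by
        simp [PartrecToTM2.trList, trNat_two_pow]
      simp only [TM2to1.trInit]
      erw [hl]
      change _ = G .cons true :: G .bit1 false ::
        List.map (fun a => G a false) (List.replicate m PartrecToTM2.Γ'.bit0)
      rw [List.map_replicate]
      rfl
    rw [h0, TM1to0.tr_eval]
    refine (TM2to1.tr_eval_dom M₂ _ _).trans ((tm2_eval_dom_iff c [2 ^ m]).trans ?_)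
    have := hc ⟨[2 ^ m], rfl⟩
    simp only at this
    rw [this]
    simp [List.Vector.head]

/-- There is one Turing machine whose halting on the words `P ++ b ^ m` is undecidable in `m`. -/
theorem exists_tm0_undecidable :
    ∃ (Γ Λ : Type) (_ : Inhabited Γ) (_ : Inhabited Λ) (_ : Finite Γ)
      (M : TM0.Machine Γ Λ) (S : Finset Λ) (P : List Γ) (b : Γ), TM0.Supports M S ∧
      ¬ ComputablePred fun m : ℕ => (TM0.eval M (P ++ List.replicate m b)).Dom := by
  -- `f (2 ^ m)` runs the program with code `m` on the input `0`
  let f : ℕ →. ℕ := fun k =>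
    (Nat.rfind fun m => Part.some (decide (2 ^ m = k))).bind fun m =>
      (Denumerable.ofNat Nat.Partrec.Code m).eval 0
  have hpow : Primrec fun m : ℕ => 2 ^ m :=
    (Primrec.nat_rec₁ 1 (Primrec.nat_mul.comp (Primrec.const 2) Primrec.snd).to₂).of_eq
      fun n => by induction n with
        | zero => rfl
        | succ n ih => simp only [ih, pow_succ]; ring
  have hf : Partrec f := by
    refine Partrec.bind (Partrec.rfind ?_) ?_
    · have : Primrec₂ fun (k m : ℕ) => decide (2 ^ m = k) :=
        (PrimrecRel.decide Primrec.eq).comp (hpow.comp Primrec.snd) Primrec.fst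
      exact this.to_comp.partrec₂
    · exact Nat.Partrec.Code.eval_part.comp
        ((Computable.ofNat _).comp Computable.snd) (Computable.const 0)
  have hdom : ∀ m, f (2 ^ m) = (Denumerable.ofNat Nat.Partrec.Code m).eval 0 := by
    intro m
    have : (Nat.rfind fun k => Part.some (decide (2 ^ k = 2 ^ m))) = Part.some m := by
      rw [Part.eq_some_iff]
      refine Nat.mem_rfind.2 ⟨by simp, fun {k} hk => ?_⟩
      simp [hk.ne]
    simp only [f, this, Part.bind_some]
  obtain ⟨Γ, Λ, i₁, i₂, i₃, M, S, P, b, hS, hM⟩ := exists_tm0_halts_iff f hf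
  refine ⟨Γ, Λ, i₁, i₂, i₃, M, S, P, b, hS, fun h => ?_⟩
  refine ComputablePred.halting_problem 0 ?_
  obtain ⟨g, hg, hg'⟩ := ComputablePred.computable_iff.1 h
  refine ComputablePred.computable_iff.2
    ⟨fun c => g (Encodable.encode c), hg.comp Computable.encode, ?_⟩
  funext c
  have h1 := congrFun hg' (Encodable.encode c)
  change (TM0.eval M _).Dom = (g _ = true) at h1
  change (c.eval 0).Dom = (g _ = true)
  rw [← h1, hM, hdom, Denumerable.ofNat_encode]

/-! ### Queue systems -/

/-- One move of the queue system with rules `R`: a rule `(x, y)` deletes the prefix `x` of the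
queue and appends `y` at its end. -/
def QueueStep {α : Type} (R : List α → List α → Prop) (B C : List α) : Prop :=
  ∃ x y s, R x y ∧ B = x ++ s ∧ C = s ++ y

/-- Reachability in the queue system with rules `R`. -/
abbrev QueueReaches {α : Type} (R : List α → List α → Prop) : List α → List α → Prop :=
  Relation.ReflTransGen (QueueStep R)

/-- The list `rs` of rules solves the word equation `A y₁ ⋯ yₙ = x₁ ⋯ xₙ T`. -/
def SolvesQueue {α : Type} (A T : List α) (rs : List (List α × List α)) : Prop :=
  A ++ (rs.map Prod.snd).flatten = (rs.map Prod.fst).flatten ++ T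

theorem exists_solvesQueue_of_reaches {α : Type} {R : List α → List α → Prop} {A T : List α}
    (h : QueueReaches R A T) : ∃ rs, (∀ r ∈ rs, R r.1 r.2) ∧ SolvesQueue A T rs := by
  induction h using Relation.ReflTransGen.head_induction_on with
  | refl => exact ⟨[], by simp, by simp [SolvesQueue]⟩
  | head hstep _ ih =>
    obtain ⟨x, y, s, hR, rfl, rfl⟩ := hstep
    obtain ⟨rs, hrs, hsol⟩ := ih
    refine ⟨(x, y) :: rs, ?_, ?_⟩
    · rintro r (_ | ⟨_, hr⟩)
      exacts [hR, hrs _ hr]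
    · simp only [SolvesQueue, List.map_cons, List.flatten_cons, List.append_assoc] at hsol ⊢
      rw [hsol]

/-- If the rules preserve the number of occurrences of `m`, and `m` occurs in a left-hand side only
as its last letter, then every solution of the word equation is a run of the queue system: as the
queue always contains `m`, it can never be a proper prefix of the left-hand side to be deleted. -/
theorem reaches_of_solvesQueue {α : Type} [DecidableEq α] {R : List α → List α → Prop} (m : α)
    (hcount : ∀ x y, R x y → y.count m = x.count m)
    (hlast : ∀ x y, R x y → ∀ s t, x = s ++ m :: t → t = [])
    {T : List α} (rs : List (List α × List α)) :
    ∀ A : List α, A.count m = 1 → (∀ r ∈ rs, R r.1 r.2) → SolvesQueue A T rs →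
      QueueReaches R A T := by
  induction rs with
  | nil =>
    intro A _ _ h
    simp only [SolvesQueue, List.map_nil, List.flatten_nil, List.append_nil, List.nil_append] at h
    rw [h]
  | cons r rs ih =>
    obtain ⟨x, y⟩ := r
    intro A hA hrs h
    have hxy : R x y := hrs _ (List.mem_cons_self ..)
    have hrs' : ∀ r ∈ rs, R r.1 r.2 := fun r hr => hrs r (List.mem_cons_of_mem _ hr)
    simp only [SolvesQueue, List.map_cons, List.flatten_cons, List.append_assoc] at h
    have hpre : ∃ s, A = x ++ s := by
      rcases List.append_eq_append_iff.1 h with ⟨u, hx, -⟩ | ⟨s, hs, -⟩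
      · have hm : m ∈ A := List.count_pos_iff.1 (by omega)
        obtain ⟨s, t, rfl⟩ := List.append_of_mem hm
        have := hlast x y hxy s (t ++ u) (by simp [hx])
        exact ⟨[], by simp_all⟩
      · exact ⟨s, hs⟩
    obtain ⟨s, rfl⟩ := hpre
    refine Relation.ReflTransGen.head ⟨x, y, s, hxy, rfl, rfl⟩ (ih (s ++ y) ?_ hrs' ?_)
    · have := hcount x y hxy
      rw [List.count_append] at hA ⊢
      omega
    · rw [List.append_assoc, List.append_cancel_left_eq] at h
      simpa [SolvesQueue] using h

/-! ### A Turing machine on a circular tape -/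

/-- Letters of circular words that describe configurations of a Turing machine. -/
inductive TapeLetter (Γ Λ : Type) : Type
  | mark : TapeLetter Γ Λ
  | tape (a : Γ) : TapeLetter Γ Λ
  | state (q : Λ) : TapeLetter Γ Λ
  | halt : TapeLetter Γ Λ

instance {Γ Λ : Type} [Finite Γ] [Finite Λ] : Finite (TapeLetter Γ Λ) :=
  Finite.of_surjective
    (fun s : Option (Option (Γ ⊕ Λ)) => match s with
      | none => TapeLetter.mark
      | some none => .halt
      | some (some (.inl a)) => .tape a
      | some (some (.inr q)) => .state q) fun c => by
    cases c with
    | mark => exact ⟨none, rfl⟩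
    | halt => exact ⟨some none, rfl⟩
    | tape a => exact ⟨some (some (.inl a)), rfl⟩
    | state q => exact ⟨some (some (.inr q)), rfl⟩

section Machine

variable {Γ Λ : Type}

open TapeLetter

theorem eq_of_append_state_eq {L R : List Γ} {p q : Λ}
    {t u : List (TapeLetter Γ Λ)}
    (h : L.map tape ++ state q :: R.map tape = t ++ state p :: u) :
    t = L.map tape ∧ p = q ∧ u = R.map tape := by
  induction L generalizing t with
  | nil =>
    rcases t with _ | ⟨a, t⟩
    · simp at h
      exact ⟨rfl, h.1.symm, h.2.symm⟩
    · have : state p ∈ R.map (tape : Γ → TapeLetter Γ Λ) := by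
        rw [(List.cons.inj h).2]; simp
      simp at this
  | cons c L ih =>
    rcases t with _ | ⟨a, t⟩
    · simp at h
    · have := List.cons.inj h
      obtain ⟨h1, h2, h3⟩ := ih this.2
      exact ⟨by rw [h1, ← this.1]; rfl, h2, h3⟩

variable [Inhabited Γ] [Inhabited Λ]

/-- The queue rules that simulate the machine `M` on the states in `S`. The copy rules rotate the
queue, the rules for `mark` add blanks at either end of the tape, and the letter `halt` erases the
tape. -/
inductive TapeRule (M : TM0.Machine Γ Λ) (S : Finset Λ) :
    List (TapeLetter Γ S) → List (TapeLetter Γ S) → Prop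
  | copy (c) : TapeRule M S [c] [c]
  | padRight : TapeRule M S [mark] [tape default, mark]
  | padLeft : TapeRule M S [mark] [mark, tape default]
  | write (q q' : S) (a b : Γ) : M q a = some (q'.1, .write b) →
      TapeRule M S [state q, tape a] [state q', tape b]
  | moveRight (q q' : S) (a : Γ) : M q a = some (q'.1, .move .right) →
      TapeRule M S [state q, tape a] [tape a, state q']
  | moveLeft (q q' : S) (a c : Γ) : M q a = some (q'.1, .move .left) →
      TapeRule M S [tape c, state q, tape a] [state q', tape c, tape a]
  | finish (q : S) (a : Γ) : M q a = none → TapeRule M S [state q, tape a] [halt]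
  | eraseRight (c : Γ) : TapeRule M S [halt, tape c] [halt]
  | eraseLeft (c : Γ) : TapeRule M S [tape c, halt] [halt]

theorem finite_tapeRule [Finite Γ] (M : TM0.Machine Γ Λ) (S : Finset Λ) :
    {r : List (TapeLetter Γ S) × List (TapeLetter Γ S) | TapeRule M S r.1 r.2}.Finite := by
  refine ((List.finite_length_le (TapeLetter Γ S) 3).prod
    (List.finite_length_le (TapeLetter Γ S) 3)).subset ?_
  rintro ⟨x, y⟩ h
  cases h <;> simp

/-- The word that describes the state `q` and the tape with the letters `L` (read from the head
outwards) to the left of the head and the letters `R` from the head on. -/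
def cfgWord {S : Finset Λ} (L R : List Γ) (q : S) : List (TapeLetter Γ S) :=
  mark :: (L.reverse.map tape ++ state q :: R.map tape)

/-- The queue `w` describes the configuration `c`, up to rotation. -/
def Describes {S : Finset Λ} (w : List (TapeLetter Γ S)) (c : TM0.Cfg Γ Λ) : Prop :=
  ∃ L R, ∃ q : S, c = ⟨q, Tape.mk' (ListBlank.mk L) (ListBlank.mk R)⟩ ∧ w.IsRotated (cfgWord L R q)

theorem mk_append_default (L : List Γ) :
    ListBlank.mk (L ++ [default]) = ListBlank.mk L :=
  Quotient.sound' (Or.inr ⟨1, rfl⟩)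

/-- The marked letter makes the representation of a circular word as a list unique. -/
theorem eq_of_cons_isRotated_cons {α : Type} {m : α} {W W' : List α} (hW : m ∉ W)
    (h : (m :: W).IsRotated (m :: W')) : W = W' := by
  obtain ⟨n, hn, h⟩ := List.isRotated_iff_mod.1 h
  rw [List.rotate_eq_drop_append_take hn] at h
  rcases n with _ | n
  · simpa using h
  · simp only [List.drop_succ_cons, List.take_succ_cons] at h
    rcases hd : List.drop n W with _ | ⟨a, r⟩
    · rw [hd] at h
      rw [List.drop_eq_nil_iff] at hd
      simpa [List.take_of_length_le hd] using h
    · rw [hd] at h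
      obtain rfl : a = m := by simpa using (List.cons.inj h).1
      exact absurd (List.mem_of_mem_drop (hd ▸ List.mem_cons_self ..)) hW

/-- A factor without the marked letter does not straddle it. -/
theorem exists_of_isRotated_append {α : Type} {m : α} {W x s : List α} (hW : m ∉ W) (hx : m ∉ x)
    (h : (x ++ s).IsRotated (m :: W)) :
    ∃ t u, W = t ++ x ++ u ∧ ∀ y, (s ++ y).IsRotated (m :: (t ++ y ++ u)) := by
  have hs : m ∈ s := by
    have : m ∈ x ++ s := h.mem_iff.2 (List.mem_cons_self ..)
    simpa [hx] using this
  obtain ⟨u, t, rfl⟩ := List.append_of_mem hs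
  have key : ∀ y, (u ++ m :: t ++ y).IsRotated (m :: (t ++ y ++ u)) := fun y => by
    have := List.isRotated_append (l := u) (l' := m :: t ++ y)
    simpa using this
  refine ⟨t, u, ?_, key⟩
  exact eq_of_cons_isRotated_cons hW (h.symm.trans (List.isRotated_append.trans (key x)))

theorem step_mk' (M : TM0.Machine Γ Λ) (q : Λ) (L : ListBlank Γ) (a : Γ) (R : List Γ) :
    TM0.step M ⟨q, Tape.mk' L (ListBlank.mk (a :: R))⟩ = (M q a).map fun x => ⟨x.1, match x.2 with
      | .move d => Tape.move d (Tape.mk' L (ListBlank.mk (a :: R)))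
      | .write b => Tape.write b (Tape.mk' L (ListBlank.mk (a :: R)))⟩ := by
  rcases h : M q a with _ | ⟨q', d | b⟩ <;> simp [TM0.step, h]

/-- A queue move on a word that describes a configuration rotates the word or pads the tape,
performs a step of the machine, or shows that the machine has halted. -/
theorem Describes.queueStep {M : TM0.Machine Γ Λ} {S : Finset Λ} {B C : List (TapeLetter Γ S)}
    {c : TM0.Cfg Γ Λ} (hB : Describes B c) (h : QueueStep (TapeRule M S) B C) :
    Describes C c ∨ (∃ c' ∈ TM0.step M c, Describes C c') ∨ TM0.step M c = none := by
  obtain ⟨L, R, q, rfl, hB⟩ := hB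
  obtain ⟨x, y, s, hR, rfl, rfl⟩ := h
  have hm : (mark : TapeLetter Γ S) ∉ L.reverse.map tape ++ state q :: R.map tape := by simp
  have hhalt : (halt : TapeLetter Γ S) ∉ x ++ s := fun hmem => by
    have := hB.mem_iff.1 hmem
    simp [cfgWord] at this
  unfold cfgWord at hB
  have pad : x = [mark] → L.reverse.map tape ++ state q :: R.map tape = s := by
    rintro rfl
    exact eq_of_cons_isRotated_cons hm hB.symm
  have factor : mark ∉ x → _ := fun hx => exists_of_isRotated_append hm hx hB
  cases hR with
  | copy c => exact Or.inl ⟨L, R, q, rfl, List.isRotated_append.trans hB⟩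
  | padRight =>
    obtain rfl := pad rfl
    refine Or.inl ⟨L, R ++ [default], q, by rw [mk_append_default], ?_⟩
    have := List.isRotated_append (l := L.reverse.map tape ++ state q :: (R ++ [default]).map tape)
      (l' := [(mark : TapeLetter Γ S)])
    simpa [cfgWord] using this
  | padLeft =>
    obtain rfl := pad rfl
    refine Or.inl ⟨L ++ [default], R, q, by rw [mk_append_default], ?_⟩
    have := List.isRotated_append (l := L.reverse.map tape ++ state q :: R.map tape)
      (l' := [(mark : TapeLetter Γ S), tape default])
    simpa [cfgWord] using this
  | write p q' a b hM =>
    obtain ⟨t, u, hW, hrot⟩ := factor (by simp)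
    obtain ⟨rfl, rfl, hu⟩ := eq_of_append_state_eq (L := L.reverse) (u := tape a :: u) (t := t)
      (by simpa only [List.append_assoc, List.cons_append, List.nil_append] using hW)
    obtain ⟨a', R, rfl, ha, rfl⟩ := List.map_eq_cons_iff.1 hu.symm
    obtain rfl : a' = a := by simpa using ha
    refine Or.inr (Or.inl ⟨⟨q', Tape.mk' (ListBlank.mk L) (ListBlank.mk (b :: R))⟩, ?_,
      L, b :: R, q', rfl, ?_⟩)
    · simp [step_mk', hM]
    · simpa [cfgWord] using hrot [state q', tape b]
  | moveRight p q' a hM =>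
    obtain ⟨t, u, hW, hrot⟩ := factor (by simp)
    obtain ⟨rfl, rfl, hu⟩ := eq_of_append_state_eq (L := L.reverse) (u := tape a :: u) (t := t)
      (by simpa only [List.append_assoc, List.cons_append, List.nil_append] using hW)
    obtain ⟨a', R, rfl, ha, rfl⟩ := List.map_eq_cons_iff.1 hu.symm
    obtain rfl : a' = a := by simpa using ha
    refine Or.inr (Or.inl ⟨⟨q', Tape.mk' (ListBlank.mk (a' :: L)) (ListBlank.mk R)⟩, ?_,
      a' :: L, R, q', rfl, ?_⟩)
    · simp [step_mk', hM]
    · simpa [cfgWord] using hrot [tape a', state q']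
  | moveLeft p q' a c hM =>
    obtain ⟨t, u, hW, hrot⟩ := factor (by simp)
    obtain ⟨ht, rfl, hu⟩ := eq_of_append_state_eq (L := L.reverse) (u := tape a :: u)
      (t := t ++ [tape c])
      (by simpa only [List.append_assoc, List.cons_append, List.nil_append] using hW)
    obtain ⟨a', R, rfl, ha, rfl⟩ := List.map_eq_cons_iff.1 hu.symm
    obtain rfl : a' = a := by simpa using ha
    have ht' : tape c :: t.reverse = L.map tape := by
      simpa using congrArg List.reverse ht
    obtain ⟨c', L, rfl, hc, hLt⟩ := List.map_eq_cons_iff.1 ht'.symm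
    obtain rfl : c' = c := by simpa using hc
    obtain rfl : t = L.reverse.map tape := by
      rw [List.map_reverse, hLt, List.reverse_reverse]
    refine Or.inr (Or.inl ⟨⟨q', Tape.mk' (ListBlank.mk L) (ListBlank.mk (c' :: a' :: R))⟩, ?_,
      L, c' :: a' :: R, q', rfl, ?_⟩)
    · simp [step_mk', hM]
    · simpa [cfgWord] using hrot [state q', tape c', tape a']
  | finish p a hM =>
    obtain ⟨t, u, hW, hrot⟩ := factor (by simp)
    obtain ⟨rfl, rfl, hu⟩ := eq_of_append_state_eq (L := L.reverse) (u := tape a :: u) (t := t)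
      (by simpa only [List.append_assoc, List.cons_append, List.nil_append] using hW)
    obtain ⟨a', R, rfl, ha, rfl⟩ := List.map_eq_cons_iff.1 hu.symm
    obtain rfl : a' = a := by simpa using ha
    exact Or.inr (Or.inr (by simp [step_mk', hM]))
  | eraseRight c => exact absurd (by simp) hhalt
  | eraseLeft c => exact absurd (by simp) hhalt

theorem QueueReaches.of_isRotated {M : TM0.Machine Γ Λ} {S : Finset Λ}
    {w w' : List (TapeLetter Γ S)} (h : w.IsRotated w') : QueueReaches (TapeRule M S) w w' := by
  have key : ∀ u v : List (TapeLetter Γ S), QueueReaches (TapeRule M S) (u ++ v) (v ++ u) := by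
    intro u
    induction u with
    | nil => intro v; simpa using Relation.ReflTransGen.refl
    | cons c u ih =>
      intro v
      refine Relation.ReflTransGen.head ⟨[c], [c], u ++ v, .copy c, rfl, rfl⟩ ?_
      simpa using ih (v ++ [c])
  obtain ⟨n, hn, rfl⟩ := List.isRotated_iff_mod.1 h
  rw [List.rotate_eq_drop_append_take hn]
  simpa using key (w.take n) (w.drop n)

/-- Rules apply anywhere in a word, thanks to the copy rules. -/
theorem QueueReaches.of_rule {M : TM0.Machine Γ Λ} {S : Finset Λ}
    {x y : List (TapeLetter Γ S)} (h : TapeRule M S x y) (p s : List (TapeLetter Γ S)) :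
    QueueReaches (TapeRule M S) (p ++ (x ++ s)) (p ++ (y ++ s)) := by
  refine (QueueReaches.of_isRotated List.isRotated_append).trans
    (Relation.ReflTransGen.head ⟨x, y, s ++ p, h, by simp, rfl⟩
      (QueueReaches.of_isRotated ?_))
  have := List.isRotated_append (l := s) (l' := p ++ y)
  simpa using this

/-- Padding makes the letter under the head and its left neighbour explicit. -/
theorem exists_padded (M : TM0.Machine Γ Λ) {S : Finset Λ} (L R : List Γ) (q : S) :
    ∃ c L' a R', ListBlank.mk (c :: L') = ListBlank.mk L ∧
      ListBlank.mk (a :: R') = ListBlank.mk R ∧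
      QueueReaches (TapeRule M S) (cfgWord L R q) (cfgWord (c :: L') (a :: R') q) := by
  have hL : ∃ c L', ListBlank.mk (c :: L') = ListBlank.mk L ∧
      QueueReaches (TapeRule M S) (cfgWord L R q) (cfgWord (c :: L') R q) := by
    rcases L with _ | ⟨c, L⟩
    · refine ⟨default, [], mk_append_default [], ?_⟩
      simpa [cfgWord] using QueueReaches.of_rule (.padLeft (M := M)) [] (state q :: R.map tape)
    · exact ⟨c, L, rfl, .refl⟩
  obtain ⟨c, L', hL, hr⟩ := hL
  rcases R with _ | ⟨a, R⟩
  · refine ⟨c, L', default, [], hL, mk_append_default [], hr.trans ?_⟩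
    refine Relation.ReflTransGen.head ⟨_, _, _, .padRight, rfl, rfl⟩
      (QueueReaches.of_isRotated ?_)
    have := List.isRotated_append
      (l := (c :: L').reverse.map tape ++ [state q, tape default]) (l' := [mark])
    simpa [cfgWord] using this
  · exact ⟨c, L', a, R, hL, rfl, hr⟩

/-- Every step of the machine is simulated by queue moves. -/
theorem exists_queueReaches_of_step {M : TM0.Machine Γ Λ} {S : Finset Λ}
    (hS : TM0.Supports M S) {w : List (TapeLetter Γ S)} {c c' : TM0.Cfg Γ Λ}
    (hw : Describes w c) (h : c' ∈ TM0.step M c) :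
    ∃ w', Describes w' c' ∧ QueueReaches (TapeRule M S) w w' := by
  obtain ⟨L, R, q, rfl, hrot⟩ := hw
  obtain ⟨b, L, a, R, hL, hR, hr⟩ := exists_padded M L R q
  have hr := (QueueReaches.of_isRotated (M := M) hrot).trans hr
  rw [← hL, ← hR, step_mk', Option.mem_def, Option.map_eq_some_iff] at h
  obtain ⟨⟨p, st⟩, hM, rfl⟩ := h
  have hp : p ∈ S := hS.2 hM q.2
  lift p to S using hp
  rcases st with (_ | _) | d
  · refine ⟨_, ⟨L, b :: a :: R, p, by simp, .refl _⟩, hr.trans ?_⟩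
    simpa [cfgWord] using QueueReaches.of_rule (.moveLeft q p a b hM)
      (mark :: L.reverse.map tape) (R.map tape)
  · refine ⟨_, ⟨a :: b :: L, R, p, by simp, .refl _⟩, hr.trans ?_⟩
    simpa [cfgWord] using QueueReaches.of_rule (.moveRight q p a hM)
      (mark :: (b :: L).reverse.map tape) (R.map tape)
  · refine ⟨_, ⟨b :: L, d :: R, p, by simp, .refl _⟩, hr.trans ?_⟩
    simpa [cfgWord] using QueueReaches.of_rule (.write q p a d hM)
      (mark :: (b :: L).reverse.map tape) (R.map tape)

theorem queueReaches_erase (M : TM0.Machine Γ Λ) {S : Finset Λ} (L R : List Γ) :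
    QueueReaches (TapeRule M S) (mark :: (L.reverse.map tape ++ halt :: R.map tape))
      [mark, halt] := by
  induction R with
  | nil =>
    induction L with
    | nil => exact .refl
    | cons c L ih =>
      refine .trans ?_ ih
      simpa using QueueReaches.of_rule (.eraseLeft (M := M) c) (mark :: L.reverse.map tape) []
  | cons c R ih =>
    refine .trans ?_ ih
    simpa using QueueReaches.of_rule (.eraseRight (M := M) c) (mark :: L.reverse.map tape)
      (R.map tape)

theorem queueReaches_of_halted {M : TM0.Machine Γ Λ} {S : Finset Λ}
    {w : List (TapeLetter Γ S)} {c : TM0.Cfg Γ Λ} (hw : Describes w c)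
    (h : TM0.step M c = none) : QueueReaches (TapeRule M S) w [mark, halt] := by
  obtain ⟨L, R, q, rfl, hrot⟩ := hw
  obtain ⟨b, L, a, R, hL, hR, hr⟩ := exists_padded M L R q
  have hr := (QueueReaches.of_isRotated (M := M) hrot).trans hr
  rw [← hL, ← hR, step_mk', Option.map_eq_none_iff] at h
  refine (hr.trans ?_).trans (queueReaches_erase M (b :: L) R)
  simpa [cfgWord] using QueueReaches.of_rule (.finish q a h)
    (mark :: (b :: L).reverse.map tape) (R.map tape)

/-- The queue can be reduced to `[mark, halt]` if and only if the machine halts. -/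
theorem queueReaches_iff_eval_dom {M : TM0.Machine Γ Λ} {S : Finset Λ}
    (hS : TM0.Supports M S) {w : List (TapeLetter Γ S)} {l : List Γ}
    (hw : Describes w (TM0.init l)) :
    QueueReaches (TapeRule M S) w [mark, halt] ↔ (TM0.eval M l).Dom := by
  have hdom : (TM0.eval M l).Dom ↔
      ∃ c, StateTransition.Reaches (TM0.step M) (TM0.init l) c ∧ TM0.step M c = none := by
    exact (Part.dom_iff_mem (o := StateTransition.eval (TM0.step M) (TM0.init l))).trans
      (exists_congr fun c => StateTransition.mem_eval)
  rw [hdom]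
  constructor
  · intro h
    have inv : ∀ C, QueueReaches (TapeRule M S) w C →
        (∃ c, StateTransition.Reaches (TM0.step M) (TM0.init l) c ∧ Describes C c) ∨
        ∃ c, StateTransition.Reaches (TM0.step M) (TM0.init l) c ∧ TM0.step M c = none := by
      intro C hC
      induction hC with
      | refl => exact Or.inl ⟨_, .refl, hw⟩
      | tail _ hstep ih =>
        rcases ih with ⟨c, hc, hd⟩ | ih
        · rcases hd.queueStep hstep with h | ⟨c', hc', h⟩ | h
          · exact Or.inl ⟨c, hc, h⟩
          · exact Or.inl ⟨c', hc.tail hc', h⟩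
          · exact Or.inr ⟨c, hc, h⟩
        · exact Or.inr ih
    rcases inv _ h with ⟨c, -, L, R, q, -, hrot⟩ | h
    · have : halt ∈ cfgWord L R q := hrot.mem_iff.1 (by simp)
      simp [cfgWord] at this
    · exact h
  · rintro ⟨c, hc, hnone⟩
    have : ∃ w', Describes w' c ∧ QueueReaches (TapeRule M S) w w' := by
      clear hnone
      induction hc with
      | refl => exact ⟨w, hw, .refl⟩
      | tail _ hstep ih =>
        obtain ⟨w', hd, hr⟩ := ih
        obtain ⟨w'', hd', hr'⟩ := exists_queueReaches_of_step hS hd hstep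
        exact ⟨w'', hd', hr.trans hr'⟩
    obtain ⟨w', hd, hr⟩ := this
    exact hr.trans (queueReaches_of_halted hd hnone)

end Machine

/-- For a fixed finite set of rules `(x, y)`, it is undecidable in `m` whether some sequence of rules
solves `bᵐ Q y₁ ⋯ yₙ = x₁ ⋯ xₙ T`. -/
theorem exists_queue_undecidable :
    ∃ (α : Type) (_ : Finite α) (R : Set (List α × List α)) (_ : R.Finite) (b : α) (Q T : List α),
      ¬ ComputablePred fun m : ℕ =>
        ∃ rs : List (List α × List α), (∀ r ∈ rs, r ∈ R) ∧
          SolvesQueue (List.replicate m b ++ Q) T rs := by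
  classical
  obtain ⟨Γ, Λ, _, _, _, M, S, P, b, hS, hM⟩ := exists_tm0_undecidable
  let q₀ : S := ⟨default, hS.1⟩
  refine ⟨TapeLetter Γ S, inferInstance, {r | TapeRule M S r.1 r.2}, finite_tapeRule M S,
    .tape b, .mark :: .state q₀ :: P.map .tape, [.mark, .halt], fun h => hM ?_⟩
  convert h using 2 with m
  have hw : Describes (List.replicate m (.tape b) ++ .mark :: .state q₀ :: P.map .tape)
      (TM0.init (P ++ List.replicate m b) : TM0.Cfg Γ Λ) := by
    refine ⟨[], P ++ List.replicate m b, q₀, rfl, ?_⟩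
    have := List.isRotated_append (l := List.replicate m (TapeLetter.tape b))
      (l' := TapeLetter.mark :: TapeLetter.state q₀ :: P.map .tape)
    simpa [cfgWord] using this
  rw [← queueReaches_iff_eval_dom hS hw]
  refine ⟨exists_solvesQueue_of_reaches, ?_⟩
  rintro ⟨rs, hrs, hsol⟩
  refine reaches_of_solvesQueue TapeLetter.mark ?_ ?_ rs _ ?_ hrs hsol
  · intro x y hR
    cases hR <;> simp [List.count_cons]
  · intro x y hR s t hx
    cases hR <;> rcases s with _ | ⟨_, _ | ⟨_, _ | ⟨_, s⟩⟩⟩ <;> simp_all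
  · have h1 : List.count (TapeLetter.mark : TapeLetter Γ S) (P.map .tape) = 0 :=
      List.count_eq_zero.2 (by simp)
    simp [List.count_replicate, h1]

/-! ### Binary alphabet -/

/-- The prefix code that writes the letter number `k` as `k` times `true` followed by `false`. -/
def unaryCode {α : Type} (f : α → ℕ) (w : List α) : List Bool :=
  w.flatMap fun c => List.replicate (f c) true ++ [false]

theorem unaryCode_append {α : Type} (f : α → ℕ) (w w' : List α) :
    unaryCode f (w ++ w') = unaryCode f w ++ unaryCode f w' := by
  simp [unaryCode]

theorem unaryCode_flatten {α : Type} (f : α → ℕ) (ws : List (List α)) :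
    unaryCode f ws.flatten = (ws.map (unaryCode f)).flatten := by
  induction ws with
  | nil => rfl
  | cons w ws ih => simp [unaryCode_append, ih]

theorem unaryCode_injective {α : Type} {f : α → ℕ} (hf : Function.Injective f) :
    Function.Injective (unaryCode f) := by
  have key : ∀ (k l : ℕ) (u v : List Bool),
      List.replicate k true ++ false :: u = List.replicate l true ++ false :: v →
        k = l ∧ u = v := by
    intro k
    induction k with
    | zero =>
      intro l u v h
      cases l <;> simp_all [List.replicate_succ]
    | succ k ih =>
      intro l u v h
      cases l with
      | zero => simp [List.replicate_succ] at h
      | succ l => simpa using ih l u v (by simpa [List.replicate_succ] using h)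
  intro w
  induction w with
  | nil =>
    intro w' h
    cases w' with
    | nil => rfl
    | cons c w' => simp [unaryCode] at h
  | cons c w ih =>
    intro w' h
    cases w' with
    | nil => simp [unaryCode] at h
    | cons c' w' =>
      obtain ⟨h1, h2⟩ := key (f c) (f c') (unaryCode f w) (unaryCode f w')
        (by simpa [unaryCode] using h)
      rw [hf h1, ih h2]

/-- The undecidable word equation over a binary alphabet. The letter `b` that is repeated in the start
word gets the number `0`, so that its code is the single letter `false`. -/
theorem exists_binary_queue_undecidable :
    ∃ (R : Set (List Bool × List Bool)) (_ : R.Finite) (Q T : List Bool),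
      ¬ ComputablePred fun m : ℕ =>
        ∃ rs : List (List Bool × List Bool), (∀ r ∈ rs, r ∈ R) ∧
          SolvesQueue (List.replicate m false ++ Q) T rs := by
  obtain ⟨α, _, R, hR, b, Q, T, h⟩ := exists_queue_undecidable
  obtain ⟨f, hf, hfb⟩ : ∃ f : α → ℕ, Function.Injective f ∧ f b = 0 := by
    classical
    obtain ⟨n, ⟨g⟩⟩ := Finite.exists_equiv_fin α
    refine ⟨Equiv.swap 0 (g b : ℕ) ∘ Fin.val ∘ g,
      (Equiv.injective _).comp (Fin.val_injective.comp g.injective), by simp⟩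
  let E : List α × List α → List Bool × List Bool := Prod.map (unaryCode f) (unaryCode f)
  refine ⟨E '' R, hR.image E, unaryCode f Q, unaryCode f T, fun hc => h ?_⟩
  convert hc using 2 with m
  have hb : unaryCode f (List.replicate m b) = List.replicate m false := by
    induction m with
    | zero => rfl
    | succ m ih => simpa [List.replicate_succ, unaryCode, hfb] using ih
  have hsolve : ∀ rs : List (List α × List α),
      SolvesQueue (List.replicate m b ++ Q) T rs ↔
        SolvesQueue (List.replicate m false ++ unaryCode f Q) (unaryCode f T) (rs.map E) := by
    intro rs
    unfold SolvesQueue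
    rw [← (unaryCode_injective hf).eq_iff]
    simp only [unaryCode_append, unaryCode_flatten, hb, List.map_map]
    rfl
  constructor
  · rintro ⟨rs, hrs, hsol⟩
    refine ⟨rs.map E, fun r hr => ?_, (hsolve rs).1 hsol⟩
    obtain ⟨r₀, hr₀, rfl⟩ := List.mem_map.1 hr
    exact ⟨r₀, hrs r₀ hr₀, rfl⟩
  · rintro ⟨rs', hrs', hsol⟩
    have hlift : ∃ rs : List (List α × List α), (∀ r ∈ rs, r ∈ R) ∧ rs.map E = rs' := by
      clear hsol
      induction rs' with
      | nil => exact ⟨[], by simp, rfl⟩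
      | cons r rs' ih =>
        obtain ⟨rs, h1, rfl⟩ := ih fun r hr => hrs' r (List.mem_cons_of_mem _ hr)
        obtain ⟨r, hr, rfl⟩ := hrs' r (List.mem_cons_self ..)
        exact ⟨r :: rs, by simpa [hr] using h1, rfl⟩
    obtain ⟨rs, hrs, rfl⟩ := hlift
    exact ⟨rs, hrs, (hsolve rs).2 hsol⟩

/-! ### Two unitary matrices that generate a free monoid up to scalars -/

/-- The matrices `A` and `B` are proportional: all cross products agree. -/
def Proportional {R n : Type} [Mul R] (A B : Matrix n n R) : Prop :=
  ∀ i j k l, A i j * B k l = A k l * B i j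

theorem Proportional.mul_left {R n : Type} [CommRing R] [Fintype n] {A B : Matrix n n R}
    (h : Proportional A B) (X : Matrix n n R) : Proportional (X * A) (X * B) := by
  intro i j k l
  simp only [Matrix.mul_apply, Finset.sum_mul_sum]
  rw [Finset.sum_comm]
  refine Finset.sum_congr rfl fun a _ => Finset.sum_congr rfl fun b _ => ?_
  linear_combination X i b * X k a * h b j a l

theorem Proportional.of_mul_left {R n : Type} [CommRing R] [IsDomain R] [Fintype n]
    [DecidableEq n] {A B X : Matrix n n R} (hX : X.det ≠ 0)
    (h : Proportional (X * A) (X * B)) : Proportional A B := by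
  have h' := h.mul_left X.adjugate
  simp only [← Matrix.mul_assoc, Matrix.adjugate_mul, Matrix.smul_mul, one_mul] at h'
  intro i j k l
  have := h' i j k l
  simp only [Matrix.smul_apply, smul_eq_mul] at this
  refine mul_left_cancel₀ (mul_ne_zero hX hX) ?_
  linear_combination this

theorem Proportional.map {R S n : Type} [CommRing R] [CommRing S] (φ : R →+* S)
    {A B : Matrix n n R} (h : Proportional A B) : Proportional (A.map φ) (B.map φ) := by
  intro i j k l
  simp only [Matrix.map_apply, ← map_mul, h i j k l]

/-- Five times the unitary generators, as matrices of Gaussian integers. -/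
def generatorInt : Bool → Matrix (Fin 2) (Fin 2) GaussianInt
  | false => !![⟨3, 4⟩, 0; 0, 5]
  | true => !![3, 4; -4, 3]

theorem det_generatorInt_ne_zero (c : Bool) : (generatorInt c).det ≠ 0 := by
  cases c <;> simp only [generatorInt, Matrix.det_fin_two_of] <;> decide

/-- Reduction of Gaussian integers modulo the prime `2 - i`. -/
def gaussianMod : GaussianInt →+* ZMod 5 :=
  Zsqrtd.lift ⟨2, by decide⟩

/-- The column spaces of the two generators modulo `2 - i`. -/
def generatorColumn : Bool → Fin 2 → ZMod 5
  | false => ![1, 0]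
  | true => ![3, 1]

/-- The row spaces of the two generators modulo `2 - i`. -/
def generatorRow : Bool → Fin 2 → ZMod 5
  | false => ![1, 0]
  | true => ![1, 3]

theorem generatorInt_map (c : Bool) :
    (generatorInt c).map gaussianMod = Matrix.vecMulVec (generatorColumn c) (generatorRow c) := by
  ext i j
  cases c <;> fin_cases i <;> fin_cases j <;> rfl

theorem generatorRow_dotProduct_ne_zero (c c' : Bool) :
    generatorRow c ⬝ᵥ generatorColumn c' ≠ 0 := by
  cases c <;> cases c' <;> decide

/-- The value of a word in the generators. -/
def wordInt (w : List Bool) : Matrix (Fin 2) (Fin 2) GaussianInt :=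
  (w.map generatorInt).prod

instance : Fact (Nat.Prime 5) := ⟨by norm_num⟩

/-- Modulo `2 - i`, a nonempty word has rank one, and its column space shows the first letter. -/
theorem exists_wordInt_map_eq (c : Bool) (w : List Bool) :
    ∃ r : Fin 2 → ZMod 5, r ≠ 0 ∧
      (wordInt (c :: w)).map gaussianMod = Matrix.vecMulVec (generatorColumn c) r := by
  induction w generalizing c with
  | nil =>
    refine ⟨generatorRow c, ?_, by simp [wordInt, generatorInt_map]⟩
    cases c <;> decide
  | cons c' w ih =>
    obtain ⟨r, hr, h⟩ := ih c'
    refine ⟨(generatorRow c ⬝ᵥ generatorColumn c') • r,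
      smul_ne_zero (generatorRow_dotProduct_ne_zero c c') hr, ?_⟩
    have : wordInt (c :: c' :: w) = generatorInt c * wordInt (c' :: w) := by simp [wordInt]
    rw [this, Matrix.map_mul, h, generatorInt_map, Matrix.vecMulVec_mul_vecMulVec]

theorem eq_of_proportional_wordInt (w w' : List Bool) (h : Proportional (wordInt w) (wordInt w')) :
    w = w' := by
  have hnil : ∀ (c : Bool) (w : List Bool),
      ¬ Proportional ((1 : Matrix (Fin 2) (Fin 2) GaussianInt).map gaussianMod)
        ((wordInt (c :: w)).map gaussianMod) := by
    intro c w h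
    obtain ⟨r, hr, he⟩ := exists_wordInt_map_eq c w
    rw [he, Matrix.map_one _ (map_zero _) (map_one _)] at h
    have h1 := h 0 0 0 1
    have h2 := h 0 0 1 0
    have h3 := h 0 0 1 1
    refine hr (funext fun i => ?_)
    cases c <;> fin_cases i <;>
      simp_all [Matrix.vecMulVec_apply, generatorColumn]
  have hcol : ∀ w w' : List Bool,
      ¬ Proportional ((wordInt (false :: w)).map gaussianMod)
        ((wordInt (true :: w')).map gaussianMod) := by
    intro w w' h
    obtain ⟨r, hr, he⟩ := exists_wordInt_map_eq false w
    obtain ⟨r', hr', he'⟩ := exists_wordInt_map_eq true w'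
    rw [he, he'] at h
    obtain ⟨j, hj⟩ := Function.ne_iff.1 hr
    obtain ⟨l, hl⟩ := Function.ne_iff.1 hr'
    have := h 0 j 1 l
    simp [Matrix.vecMulVec_apply, generatorColumn] at this
    tauto
  have symm : ∀ {A B : Matrix (Fin 2) (Fin 2) (ZMod 5)}, Proportional A B → Proportional B A :=
    fun h i j k l => by rw [mul_comm, ← h, mul_comm]
  induction w generalizing w' with
  | nil =>
    cases w' with
    | nil => rfl
    | cons c w' => exact absurd (h.map gaussianMod) (hnil c w')
  | cons c w ih =>
    cases w' with
    | nil => exact absurd (symm (h.map gaussianMod)) (hnil c w)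
    | cons c' w' =>
      have hc : c = c' := by
        cases c <;> cases c'
        · rfl
        · exact absurd (h.map gaussianMod) (hcol w w')
        · exact absurd (symm (h.map gaussianMod)) (hcol w' w)
        · rfl
      subst hc
      rw [ih w' (Proportional.of_mul_left (det_generatorInt_ne_zero c)
        (by simpa [wordInt] using h))]

/-- The unitary matrix of a word: the product of its letters, `false` standing for
`diag ((3 + 4 i) / 5, 1)` and `true` for a rotation by `arctan (4 / 3)`. -/
noncomputable def wordUnitary (w : List Bool) : Matrix (Fin 2) (Fin 2) ℂ :=
  (w.map fun c => (1 / 5 : ℂ) • (generatorInt c).map GaussianInt.toComplex).prod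

theorem wordUnitary_append (w w' : List Bool) :
    wordUnitary (w ++ w') = wordUnitary w * wordUnitary w' := by
  simp [wordUnitary]

theorem wordUnitary_eq_smul (w : List Bool) :
    wordUnitary w = (1 / 5 : ℂ) ^ w.length • (wordInt w).map GaussianInt.toComplex := by
  induction w with
  | nil => simp [wordUnitary, wordInt]
  | cons c w ih =>
    have h1 : wordUnitary (c :: w) =
        ((1 / 5 : ℂ) • (generatorInt c).map GaussianInt.toComplex) * wordUnitary w := by
      simp [wordUnitary]
    have h2 : wordInt (c :: w) = generatorInt c * wordInt w := by simp [wordInt]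
    rw [h1, h2, ih, Matrix.map_mul, Matrix.smul_mul, Matrix.mul_smul, smul_smul, List.length_cons,
      pow_succ']

theorem eq_of_proportional_wordUnitary {w w' : List Bool}
    (h : Proportional (wordUnitary w) (wordUnitary w')) : w = w' := by
  refine eq_of_proportional_wordInt w w' fun i j k l => ?_
  have := h i j k l
  simp only [wordUnitary_eq_smul, Matrix.smul_apply, Matrix.map_apply, smul_eq_mul] at this
  have h5 : ∀ n : ℕ, (1 / 5 : ℂ) ^ n ≠ 0 := fun n => pow_ne_zero _ (by norm_num)
  apply GaussianInt.toComplex_injective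
  rw [map_mul, map_mul]
  refine mul_left_cancel₀ (mul_ne_zero (h5 w.length) (h5 w'.length)) ?_
  linear_combination this

theorem wordUnitary_mem_unitaryGroup (w : List Bool) :
    wordUnitary w ∈ Matrix.unitaryGroup (Fin 2) ℂ := by
  refine Submonoid.list_prod_mem _ fun U hU => ?_
  obtain ⟨c, -, rfl⟩ := List.mem_map.1 hU
  rw [Matrix.mem_unitaryGroup_iff]
  ext i j
  cases c <;> fin_cases i <;> fin_cases j <;>
    simp [generatorInt, Matrix.mul_apply, Fin.sum_univ_two, Matrix.star_apply,
      GaussianInt.toComplex_def, Complex.ext_iff] <;> norm_num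

/-! ### Unitary channels and pure states -/

theorem ampliate_conjOp {d : ℕ} (K : Matrix (Fin d) (Fin d) ℂ) (n : ℕ)
    (X : Matrix (Fin d × Fin n) (Fin d × Fin n) ℂ) :
    (conjOp K).ampliate n X =
      Matrix.kronecker K (1 : Matrix (Fin n) (Fin n) ℂ) * X *
        (Matrix.kronecker K (1 : Matrix (Fin n) (Fin n) ℂ)).conjTranspose := by
  ext ⟨a, s⟩ ⟨b, t⟩
  simp [SuperOp.ampliate, conjOp_apply, Matrix.mul_apply, Fintype.sum_prod_type,
    Matrix.kronecker, Matrix.kroneckerMap_apply, Matrix.one_apply, Matrix.conjTranspose_apply,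
    apply_ite (starRingEnd ℂ)]

theorem isCPTP_conjOp {d : ℕ} {K : Matrix (Fin d) (Fin d) ℂ} (hK : K.conjTranspose * K = 1) :
    (conjOp K).IsCPTP := by
  refine ⟨fun n X hX => ?_, fun X => ?_⟩
  · rw [ampliate_conjOp]
    exact hX.mul_mul_conjTranspose_same _
  · rw [conjOp_apply, Matrix.trace_mul_comm, ← Matrix.mul_assoc, hK, one_mul]

theorem conjOp_vecMulVec {d : ℕ} (K : Matrix (Fin d) (Fin d) ℂ) (a : ℂ) (v : Fin d → ℂ) :
    conjOp K (a • Matrix.vecMulVec v (star v)) =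
      a • Matrix.vecMulVec (K.mulVec v) (star (K.mulVec v)) := by
  rw [map_smul, conjOp_apply, Matrix.mul_vecMulVec, Matrix.vecMulVec_mul, Matrix.star_mulVec]

section Embedding

variable {d : ℕ} (e : Fin d ≃ (Fin 2 × Fin 2) ⊕ Fin (d - 4))

/-- The matrix `A` as a vector in `ℂ^2 ⊗ ℂ^2`, viewed as a subspace of `ℂ^d`. -/
def matrixVec (A : Matrix (Fin 2) (Fin 2) ℂ) : Fin d → ℂ :=
  fun i => Sum.elim (fun p => A p.1 p.2) 0 (e i)

/-- The pure state of the vector of a unitary matrix `A`. -/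
noncomputable def matrixState (A : Matrix (Fin 2) (Fin 2) ℂ) : Matrix (Fin d) (Fin d) ℂ :=
  (1 / 2 : ℂ) • Matrix.vecMulVec (matrixVec e A) (star (matrixVec e A))

/-- The operator on `ℂ^d` that acts on `ℂ^2 ⊗ ℂ^2` as `A ↦ X A Y` and as the identity on the
complement. -/
def sandwichOp (X Y : Matrix (Fin 2) (Fin 2) ℂ) : Matrix (Fin d) (Fin d) ℂ :=
  (Matrix.fromBlocks (Matrix.kronecker X Y.transpose) 0 0 1).submatrix e e

theorem sandwichOp_mulVec (X Y A : Matrix (Fin 2) (Fin 2) ℂ) :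
    (sandwichOp e X Y).mulVec (matrixVec e A) = matrixVec e (X * A * Y) := by
  have h : matrixVec e A = (Sum.elim (fun p : Fin 2 × Fin 2 => A p.1 p.2) 0) ∘ e := rfl
  rw [sandwichOp, h, Matrix.submatrix_mulVec_equiv, Function.comp_assoc, Equiv.self_comp_symm,
    Function.comp_id, Matrix.fromBlocks_mulVec]
  funext i
  simp only [Function.comp_apply, matrixVec]
  rcases e i with ⟨a, b⟩ | k
  · simp [Matrix.mulVec, dotProduct, Fintype.sum_prod_type, Matrix.mul_apply, Fin.sum_univ_two,
      Matrix.kronecker, Matrix.kroneckerMap_apply, Sum.elim_comp_inl]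
    ring
  · simp

theorem conjTranspose_mul_sandwichOp {X Y : Matrix (Fin 2) (Fin 2) ℂ}
    (hX : X ∈ Matrix.unitaryGroup (Fin 2) ℂ) (hY : Y ∈ Matrix.unitaryGroup (Fin 2) ℂ) :
    (sandwichOp e X Y).conjTranspose * sandwichOp e X Y = 1 := by
  rw [Matrix.mem_unitaryGroup_iff', Matrix.star_eq_conjTranspose] at hX
  rw [Matrix.mem_unitaryGroup_iff, Matrix.star_eq_conjTranspose] at hY
  have hY' : Y.transpose.conjTranspose * Y.transpose = 1 := by
    have := congrArg Matrix.transpose hY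
    rwa [Matrix.transpose_mul, Matrix.transpose_one] at this
  rw [sandwichOp, Matrix.conjTranspose_submatrix, Matrix.submatrix_mul_equiv,
    Matrix.fromBlocks_conjTranspose, Matrix.fromBlocks_multiply, Matrix.kronecker,
    Matrix.conjTranspose_kronecker, ← Matrix.mul_kronecker_mul, hX, hY']
  simp

theorem conjOp_sandwichOp_matrixState (X Y A : Matrix (Fin 2) (Fin 2) ℂ) :
    conjOp (sandwichOp e X Y) (matrixState e A) = matrixState e (X * A * Y) := by
  rw [matrixState, conjOp_vecMulVec, sandwichOp_mulVec, matrixState]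

theorem isState_matrixState {A : Matrix (Fin 2) (Fin 2) ℂ}
    (hA : A ∈ Matrix.unitaryGroup (Fin 2) ℂ) : IsState (matrixState e A) := by
  constructor
  · exact (Matrix.posSemidef_vecMulVec_self_star _).smul (by norm_num [Complex.le_def])
  · have h1 : (A * star A).trace = 2 := by
      rw [Matrix.mem_unitaryGroup_iff.1 hA]; simp
    have h2 : ∑ i, matrixVec e A i * star (matrixVec e A i) = 2 := by
      rw [← h1, ← e.symm.sum_comp]
      simp [matrixVec, Fintype.sum_sum_type, Fintype.sum_prod_type, Matrix.trace,
        Matrix.mul_apply, Fin.sum_univ_two]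
    rw [matrixState, Matrix.trace_smul, Matrix.trace_vecMulVec]
    simp only [dotProduct, Pi.star_apply, h2, smul_eq_mul]
    norm_num

/-- A pure state determines its vector up to a phase. -/
theorem proportional_of_matrixState_eq {A B : Matrix (Fin 2) (Fin 2) ℂ}
    (h : matrixState e A = matrixState e B) : Proportional A B := by
  have key : ∀ p q : Fin 2 × Fin 2, A p.1 p.2 * star (A q.1 q.2) = B p.1 p.2 * star (B q.1 q.2) := by
    intro p q
    have := congrFun (congrFun h (e.symm (.inl p))) (e.symm (.inl q))
    simpa [matrixState, matrixVec, Matrix.vecMulVec_apply] using this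
  intro i j k l
  have h1 := key (i, j) (i, j)
  have h2 := key (k, l) (i, j)
  have h3 := key (i, j) (k, l)
  have h4 := key (k, l) (k, l)
  simp only at h1 h2 h3 h4
  by_cases hi : star (A i j) = 0
  · by_cases hk : star (A k l) = 0
    · simp_all
    · refine mul_left_cancel₀ hk ?_
      linear_combination B k l * h3 - B i j * h4
  · refine mul_left_cancel₀ hi ?_
    linear_combination B k l * h1 - B i j * h2

theorem matrixState_eq_iff {w w' : List Bool} :
    matrixState e (wordUnitary w) = matrixState e (wordUnitary w') ↔ w = w' :=
  ⟨fun h => eq_of_proportional_wordUnitary (proportional_of_matrixState_eq e h), fun h => by rw [h]⟩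

/-- The Kraus operator of the queue rule `(x, y)`: it multiplies a matrix by `x⁻¹` on the left and
by `y` on the right. -/
noncomputable def ruleOp (r : List Bool × List Bool) : Matrix (Fin d) (Fin d) ℂ :=
  sandwichOp e (star (wordUnitary r.1)) (wordUnitary r.2)

theorem isCPTP_conjOp_ruleOp (r : List Bool × List Bool) : (conjOp (ruleOp e r)).IsCPTP :=
  isCPTP_conjOp (conjTranspose_mul_sandwichOp e (Unitary.star_mem (wordUnitary_mem_unitaryGroup _))
    (wordUnitary_mem_unitaryGroup _))

/-- `Φ` sends the state of `A` to the state of `(x₁ ⋯ xₙ)⁻¹ A (y₁ ⋯ yₙ)`, where `(xᵢ, yᵢ)` are the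
rules in `rs`, applied from left to right. -/
def ActsAs (Φ : SuperOp d) (rs : List (List Bool × List Bool)) : Prop :=
  ∀ A, Φ (matrixState e A) =
    matrixState e (star (wordUnitary (rs.map Prod.fst).flatten) * A *
      wordUnitary (rs.map Prod.snd).flatten)

theorem ActsAs.one : ActsAs e 1 [] := by
  intro A
  simp [wordUnitary]

theorem ActsAs.conjOp_ruleOp (r : List Bool × List Bool) : ActsAs e (conjOp (ruleOp e r)) [r] := by
  intro A
  simp [ruleOp, conjOp_sandwichOp_matrixState]

theorem ActsAs.mul {Φ Ψ : SuperOp d} {rs ts : List (List Bool × List Bool)}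
    (hΦ : ActsAs e Φ rs) (hΨ : ActsAs e Ψ ts) : ActsAs e (Φ * Ψ) (ts ++ rs) := by
  intro A
  rw [Module.End.mul_apply, hΨ, hΦ]
  simp [wordUnitary_append, mul_assoc]

/-- Reachability of states is solvability of the word equation. -/
theorem reaches_iff_exists_solvesQueue (R : Set (List Bool × List Bool)) (F : Set (SuperOp d))
    (hF : F = insert 1 ((fun r => conjOp (ruleOp e r)) '' R)) (W T : List Bool) :
    Reaches F (matrixState e (wordUnitary W)) (matrixState e (wordUnitary T)) ↔
      ∃ rs : List (List Bool × List Bool), (∀ r ∈ rs, r ∈ R) ∧ SolvesQueue W T rs := by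
  have hsolve : ∀ (Φ : SuperOp d) (rs : List (List Bool × List Bool)), ActsAs e Φ rs →
      (Φ (matrixState e (wordUnitary W)) = matrixState e (wordUnitary T) ↔
        SolvesQueue W T rs) := by
    intro Φ rs h
    rw [h]
    set x := (rs.map Prod.fst).flatten
    set y := (rs.map Prod.snd).flatten
    have hx := wordUnitary_mem_unitaryGroup x
    have hcancel : ∀ A, matrixState e (star (wordUnitary x) * A) =
        conjOp (sandwichOp e (star (wordUnitary x)) 1) (matrixState e A) := fun A => by
      rw [conjOp_sandwichOp_matrixState, mul_one]
    have hcancel' : ∀ A, matrixState e (wordUnitary x * A) =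
        conjOp (sandwichOp e (wordUnitary x) 1) (matrixState e A) := fun A => by
      rw [conjOp_sandwichOp_matrixState, mul_one]
    -- the factor `x⁻¹` moves to the other side by a unitary channel
    have h1 : matrixState e (star (wordUnitary x) * wordUnitary W * wordUnitary y) =
        matrixState e (wordUnitary T) ↔
        matrixState e (wordUnitary (W ++ y)) = matrixState e (wordUnitary (x ++ T)) := by
      constructor
      · intro h
        rw [wordUnitary_append x, hcancel', ← h, ← hcancel', ← mul_assoc, ← mul_assoc,
          Matrix.mem_unitaryGroup_iff.1 hx, one_mul, wordUnitary_append]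
      · intro h
        rw [mul_assoc, ← wordUnitary_append, hcancel, h, ← hcancel, wordUnitary_append,
          ← mul_assoc, Matrix.mem_unitaryGroup_iff'.1 hx, one_mul]
    rw [h1, matrixState_eq_iff]
    rfl
  subst hF
  constructor
  · rintro ⟨Φ, hΦ, h⟩
    have : ∃ rs : List (List Bool × List Bool), (∀ r ∈ rs, r ∈ R) ∧ ActsAs e Φ rs := by
      clear h
      induction hΦ using Subsemigroup.closure_induction with
      | mem Φ hΦ =>
        rcases hΦ with rfl | ⟨r, hr, rfl⟩
        · exact ⟨[], by simp, ActsAs.one e⟩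
        · exact ⟨[r], by simpa using hr, ActsAs.conjOp_ruleOp e r⟩
      | mul Φ Ψ _ _ ih ih' =>
        obtain ⟨rs, hrs, h⟩ := ih
        obtain ⟨ts, hts, h'⟩ := ih'
        refine ⟨ts ++ rs, fun r hr => ?_, h.mul e h'⟩
        rcases List.mem_append.1 hr with hr | hr
        exacts [hts r hr, hrs r hr]
    obtain ⟨rs, hrs, hact⟩ := this
    exact ⟨rs, hrs, (hsolve Φ rs hact).1 h⟩
  · rintro ⟨rs, hrs, hsol⟩
    have : ∃ Φ ∈ generatedSemigroup (insert 1 ((fun r => conjOp (ruleOp e r)) '' R)),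
        ActsAs e Φ rs := by
      clear hsol
      induction rs with
      | nil => exact ⟨1, Subsemigroup.subset_closure (Set.mem_insert _ _), ActsAs.one e⟩
      | cons r rs ih =>
        obtain ⟨Φ, hΦ, h⟩ := ih fun r hr => hrs r (List.mem_cons_of_mem _ hr)
        refine ⟨Φ * conjOp (ruleOp e r), mul_mem hΦ (Subsemigroup.subset_closure
          (Set.mem_insert_of_mem _ ⟨r, hrs r (List.mem_cons_self ..), rfl⟩)), ?_⟩
        have hmul := h.mul e (ActsAs.conjOp_ruleOp e r)
        rwa [List.singleton_append] at hmul
    obtain ⟨Φ, hΦ, hact⟩ := this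
    exact ⟨Φ, hΦ, (hsolve Φ rs hact).2 hsol⟩

end Embedding

/-! ### Computability of integer and Gaussian rational arithmetic -/

theorem encode_int_ofNat (n : ℕ) : Encodable.encode (n : ℤ) = 2 * n := rfl

theorem encode_int_negSucc (n : ℕ) : Encodable.encode (Int.negSucc n) = 2 * n + 1 := rfl

theorem primrec_int_toNat : Primrec Int.toNat := by
  have : Primrec fun z : ℤ => if Encodable.encode z % 2 = 0 then Encodable.encode z / 2 else 0 :=
    Primrec.ite (Primrec.eq.comp (Primrec.nat_mod.comp Primrec.encode (Primrec.const 2))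
      (Primrec.const 0)) (Primrec.nat_div.comp Primrec.encode (Primrec.const 2)) (Primrec.const 0)
  refine this.of_eq fun z => ?_
  rcases z with n | n
  · simp [encode_int_ofNat]
  · simp [encode_int_negSucc, Int.toNat]

theorem primrec_int_neg_toNat : Primrec fun z : ℤ => (-z).toNat := by
  have : Primrec fun z : ℤ =>
      if Encodable.encode z % 2 = 0 then 0 else Encodable.encode z / 2 + 1 :=
    Primrec.ite (Primrec.eq.comp (Primrec.nat_mod.comp Primrec.encode (Primrec.const 2))
      (Primrec.const 0)) (Primrec.const 0)
      (Primrec.succ.comp (Primrec.nat_div.comp Primrec.encode (Primrec.const 2)))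
  refine this.of_eq fun z => ?_
  rcases z with n | n
  · simp [encode_int_ofNat]
  · rw [encode_int_negSucc, if_neg (by omega)]
    simp [Int.neg_negSucc]
    omega

theorem primrec_int_sub_cast : Primrec₂ fun a b : ℕ => (a : ℤ) - (b : ℤ) := by
  have : Primrec fun p : ℕ × ℕ => if p.2 ≤ p.1 then 2 * (p.1 - p.2) else 2 * (p.2 - p.1 - 1) + 1 :=
    Primrec.ite (Primrec.nat_le.comp Primrec.snd Primrec.fst)
      (Primrec.nat_mul.comp (Primrec.const 2) (Primrec.nat_sub.comp Primrec.fst Primrec.snd))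
      (Primrec.succ.comp (Primrec.nat_mul.comp (Primrec.const 2) (Primrec.nat_sub.comp
        (Primrec.nat_sub.comp Primrec.snd Primrec.fst) (Primrec.const 1))))
  refine Primrec.encode_iff.1 (this.of_eq ?_)
  rintro ⟨a, b⟩
  by_cases h : b ≤ a
  · rw [if_pos h, ← encode_int_ofNat]
    simp [Nat.cast_sub h]
  · rw [if_neg h, ← encode_int_negSucc]
    congr 1
    simp only [Int.negSucc_eq]
    omega

/-- Primitive recursive functions into `ℤ` are differences of primitive recursive functions. -/
theorem primrec_int_of_eq_sub {α : Type} [Primcodable α] {f : α → ℤ} {g h : α → ℕ}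
    (hg : Primrec g) (hh : Primrec h) (H : ∀ a, f a = g a - h a) : Primrec f :=
  (primrec_int_sub_cast.comp hg hh).of_eq fun a => (H a).symm

theorem primrec_int_add : Primrec₂ fun x y : ℤ => x + y :=
  primrec_int_of_eq_sub
    (Primrec.nat_add.comp (primrec_int_toNat.comp Primrec.fst) (primrec_int_toNat.comp Primrec.snd))
    (Primrec.nat_add.comp (primrec_int_neg_toNat.comp Primrec.fst)
      (primrec_int_neg_toNat.comp Primrec.snd)) fun ⟨x, y⟩ => by
    push_cast; omega

theorem primrec_int_neg : Primrec fun x : ℤ => -x :=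
  primrec_int_of_eq_sub primrec_int_neg_toNat primrec_int_toNat fun x => by omega

theorem primrec_int_mul : Primrec₂ fun x y : ℤ => x * y :=
  primrec_int_of_eq_sub
    (Primrec.nat_add.comp
      (Primrec.nat_mul.comp (primrec_int_toNat.comp Primrec.fst)
        (primrec_int_toNat.comp Primrec.snd))
      (Primrec.nat_mul.comp (primrec_int_neg_toNat.comp Primrec.fst)
        (primrec_int_neg_toNat.comp Primrec.snd)))
    (Primrec.nat_add.comp
      (Primrec.nat_mul.comp (primrec_int_toNat.comp Primrec.fst)
        (primrec_int_neg_toNat.comp Primrec.snd))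
      (Primrec.nat_mul.comp (primrec_int_neg_toNat.comp Primrec.fst)
        (primrec_int_toNat.comp Primrec.snd))) fun ⟨x, y⟩ => by
    have hx : x = x.toNat - (-x).toNat := by omega
    have hy : y = y.toNat - (-y).toNat := by omega
    conv_lhs => rw [hx, hy]
    push_cast
    ring

/-- Multiplication of descriptions of Gaussian rationals. -/
def ScalarCode.mul (z w : ScalarCode) : ScalarCode :=
  (z.1 * w.1 + -(z.2.1 * w.2.1), z.1 * w.2.1 + z.2.1 * w.1, z.2.2 * w.2.2 + z.2.2 + w.2.2)

theorem ScalarCode.eval_mul (z w : ScalarCode) : (z.mul w).eval = z.eval * w.eval := by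
  have h : ∀ n : ℕ, (n : ℂ) + 1 ≠ 0 := Nat.cast_add_one_ne_zero
  have h1 : ((z.2.2 : ℂ) * w.2.2 + z.2.2 + w.2.2) + 1 = (z.2.2 + 1) * (w.2.2 + 1) := by ring
  simp only [ScalarCode.eval, ScalarCode.mul]
  push_cast
  rw [h1, div_mul_div_comm]
  congr 1
  linear_combination -(z.2.1 * w.2.1 : ℂ) * Complex.I_sq

theorem ScalarCode.primrec_mul : Primrec₂ ScalarCode.mul := by
  have a1 : Primrec fun p : ScalarCode × ScalarCode => p.1.1 := Primrec.fst.comp Primrec.fst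
  have b1 : Primrec fun p : ScalarCode × ScalarCode => p.1.2.1 :=
    Primrec.fst.comp (Primrec.snd.comp Primrec.fst)
  have n1 : Primrec fun p : ScalarCode × ScalarCode => p.1.2.2 :=
    Primrec.snd.comp (Primrec.snd.comp Primrec.fst)
  have a2 : Primrec fun p : ScalarCode × ScalarCode => p.2.1 := Primrec.fst.comp Primrec.snd
  have b2 : Primrec fun p : ScalarCode × ScalarCode => p.2.2.1 :=
    Primrec.fst.comp (Primrec.snd.comp Primrec.snd)
  have n2 : Primrec fun p : ScalarCode × ScalarCode => p.2.2.2 :=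
    Primrec.snd.comp (Primrec.snd.comp Primrec.snd)
  exact Primrec.pair
    (primrec_int_add.comp (primrec_int_mul.comp a1 a2)
      (primrec_int_neg.comp (primrec_int_mul.comp b1 b2)))
    (Primrec.pair (primrec_int_add.comp (primrec_int_mul.comp a1 b2) (primrec_int_mul.comp b1 a2))
      (Primrec.nat_add.comp (Primrec.nat_add.comp (Primrec.nat_mul.comp n1 n2) n1) n2))

/-- Matrices whose entries are geometric sequences of Gaussian rationals are computable. -/
theorem computable_geometric {d : ℕ} (r μ : Fin d → Fin d → ScalarCode) :
    Computable fun (m : ℕ) (i j : Fin d) => (ScalarCode.mul (μ i j))^[m] (r i j) := by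
  have hr : Primrec fun p : (ℕ × Fin d) × Fin d => r p.1.2 p.2 :=
    (Primrec.dom_finite fun q : Fin d × Fin d => r q.1 q.2).comp
      (Primrec.pair (Primrec.snd.comp Primrec.fst) Primrec.snd)
  have hμ : Primrec fun p : (ℕ × Fin d) × Fin d => μ p.1.2 p.2 :=
    (Primrec.dom_finite fun q : Fin d × Fin d => μ q.1 q.2).comp
      (Primrec.pair (Primrec.snd.comp Primrec.fst) Primrec.snd)
  have h : Primrec fun p : (ℕ × Fin d) × Fin d =>
      (ScalarCode.mul (μ p.1.2 p.2))^[p.1.1] (r p.1.2 p.2) :=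
    Primrec.nat_iterate (Primrec.fst.comp Primrec.fst) hr
      (ScalarCode.primrec_mul.comp (hμ.comp Primrec.fst) Primrec.snd)
  have h' : Primrec fun p : ℕ × Fin d =>
      fun j => (ScalarCode.mul (μ p.2 j))^[p.1] (r p.2 j) := Primrec.fin_curry.2 h
  have h'' : Primrec fun (m : ℕ) (i j : Fin d) => (ScalarCode.mul (μ i j))^[m] (r i j) :=
    Primrec.fin_curry.2 h'
  exact h''.to_comp

/-! ### Descriptions of the states and rules -/

/-- The subring of Gaussian rationals in `ℂ`. -/
def gaussianRat : Subring ℂ where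
  carrier := {z | ∃ a b : ℚ, z = a + b * Complex.I}
  one_mem' := ⟨1, 0, by simp⟩
  zero_mem' := ⟨0, 0, by simp⟩
  add_mem' := by
    rintro _ _ ⟨a, b, rfl⟩ ⟨c, d, rfl⟩
    exact ⟨a + c, b + d, by push_cast; ring⟩
  neg_mem' := by
    rintro _ ⟨a, b, rfl⟩
    exact ⟨-a, -b, by push_cast; ring⟩
  mul_mem' := by
    rintro _ _ ⟨a, b, rfl⟩ ⟨c, d, rfl⟩
    refine ⟨a * c - b * d, a * d + b * c, ?_⟩
    push_cast
    linear_combination (b * d : ℂ) * Complex.I_sq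

theorem star_mem_gaussianRat {z : ℂ} (hz : z ∈ gaussianRat) : star z ∈ gaussianRat := by
  obtain ⟨a, b, rfl⟩ := hz
  exact ⟨a, -b, by simp⟩

theorem toComplex_mem_gaussianRat (z : GaussianInt) : z.toComplex ∈ gaussianRat :=
  ⟨z.re, z.im, by simp [GaussianInt.toComplex_def]⟩

theorem ratCast_mem_gaussianRat (q : ℚ) : (q : ℂ) ∈ gaussianRat := ⟨q, 0, by simp⟩

theorem exists_scalarCode {z : ℂ} (hz : z ∈ gaussianRat) : ∃ c : ScalarCode, c.eval = z := by
  obtain ⟨a, b, rfl⟩ := hz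
  have ha : (a.den : ℂ) ≠ 0 := by exact_mod_cast a.den_ne_zero
  have hb : (b.den : ℂ) ≠ 0 := by exact_mod_cast b.den_ne_zero
  have hpos : 1 ≤ a.den * b.den := Nat.mul_pos a.den_pos b.den_pos
  refine ⟨(a.num * b.den, b.num * a.den, a.den * b.den - 1), ?_⟩
  simp only [ScalarCode.eval]
  rw [Nat.cast_sub hpos, Rat.cast_def a, Rat.cast_def b]
  push_cast
  field_simp
  ring

theorem exists_matrixCode {d : ℕ} {A : Matrix (Fin d) (Fin d) ℂ} (hA : ∀ i j, A i j ∈ gaussianRat) :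
    ∃ c : MatrixCode d, c.eval = A := by
  choose c hc using fun i j => exists_scalarCode (hA i j)
  exact ⟨c, by ext i j; exact hc i j⟩

theorem wordUnitary_apply_mem_gaussianRat (w : List Bool) (i j : Fin 2) :
    wordUnitary w i j ∈ gaussianRat := by
  have h5 : (1 / 5 : ℂ) ∈ gaussianRat := by simpa using ratCast_mem_gaussianRat (1 / 5)
  rw [wordUnitary_eq_smul]
  exact mul_mem (pow_mem h5 _) (toComplex_mem_gaussianRat _)

theorem matrixState_apply_mem_gaussianRat {d : ℕ} (e : Fin d ≃ (Fin 2 × Fin 2) ⊕ Fin (d - 4))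
    (w : List Bool) (i j : Fin d) : matrixState e (wordUnitary w) i j ∈ gaussianRat := by
  have h2 : (1 / 2 : ℂ) ∈ gaussianRat := by simpa using ratCast_mem_gaussianRat (1 / 2)
  have hv : ∀ i, matrixVec e (wordUnitary w) i ∈ gaussianRat := by
    intro i
    unfold matrixVec
    rcases e i with p | k
    exacts [wordUnitary_apply_mem_gaussianRat w _ _, zero_mem _]
  exact mul_mem h2 (mul_mem (hv i) (star_mem_gaussianRat (hv j)))

theorem ruleOp_apply_mem_gaussianRat {d : ℕ} (e : Fin d ≃ (Fin 2 × Fin 2) ⊕ Fin (d - 4))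
    (r : List Bool × List Bool) (i j : Fin d) : ruleOp e r i j ∈ gaussianRat := by
  simp only [ruleOp, sandwichOp, Matrix.submatrix_apply]
  rcases e i with p | k <;> rcases e j with q | l
  · exact mul_mem (star_mem_gaussianRat (wordUnitary_apply_mem_gaussianRat ..))
      (wordUnitary_apply_mem_gaussianRat ..)
  · exact zero_mem _
  · exact zero_mem _
  · simp only [Matrix.fromBlocks_apply₂₂, Matrix.one_apply]
    split_ifs
    exacts [one_mem _, zero_mem _]

/-- The eigenvalues of the diagonal operator on `ℂ^d` that multiplies matrices on the left by the
unitary of the letter `false`. -/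
noncomputable def falseEigenvalue {d : ℕ} (e : Fin d ≃ (Fin 2 × Fin 2) ⊕ Fin (d - 4)) (i : Fin d) :
    ℂ :=
  Sum.elim (fun p => ![(3 + 4 * Complex.I) / 5, 1] p.1) 1 (e i)

theorem falseEigenvalue_mem_gaussianRat {d : ℕ} (e : Fin d ≃ (Fin 2 × Fin 2) ⊕ Fin (d - 4))
    (i : Fin d) : falseEigenvalue e i ∈ gaussianRat := by
  unfold falseEigenvalue
  rcases e i with ⟨a, b⟩ | k
  · fin_cases a
    · exact ⟨3 / 5, 4 / 5, by simp; ring⟩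
    · exact one_mem _
  · exact one_mem _

/-- Prepending a letter `false` to a word multiplies the entries of its state by fixed scalars. -/
theorem matrixState_cons_false_apply {d : ℕ} (e : Fin d ≃ (Fin 2 × Fin 2) ⊕ Fin (d - 4))
    (w : List Bool) (i j : Fin d) :
    matrixState e (wordUnitary (false :: w)) i j =
      falseEigenvalue e i * star (falseEigenvalue e j) * matrixState e (wordUnitary w) i j := by
  have hv : ∀ i, matrixVec e (wordUnitary (false :: w)) i =
      falseEigenvalue e i * matrixVec e (wordUnitary w) i := by
    intro i
    have h : wordUnitary (false :: w) =
        ((1 / 5 : ℂ) • (generatorInt false).map GaussianInt.toComplex) * wordUnitary w := by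
      simp [wordUnitary]
    rw [h]
    unfold matrixVec falseEigenvalue
    rcases e i with ⟨a, b⟩ | k
    · fin_cases a <;>
        simp [Matrix.mul_apply, Fin.sum_univ_two, generatorInt, GaussianInt.toComplex_def]
      exact Or.inl (by ring)
    · simp
  simp only [matrixState, Matrix.smul_apply, Matrix.vecMulVec_apply, Pi.star_apply, hv, star_mul',
    smul_eq_mul]
  ring

/-- The states of the words `falseᵐ Q` have computable descriptions. -/
theorem exists_computable_matrixState {d : ℕ} (e : Fin d ≃ (Fin 2 × Fin 2) ⊕ Fin (d - 4))
    (Q : List Bool) :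
    ∃ ρ : ℕ → MatrixCode d, Computable ρ ∧
      ∀ m, (ρ m).eval = matrixState e (wordUnitary (List.replicate m false ++ Q)) := by
  obtain ⟨r, hr⟩ := exists_matrixCode (matrixState_apply_mem_gaussianRat e Q)
  obtain ⟨μ, hμ⟩ := exists_matrixCode
    (A := Matrix.of fun i j => falseEigenvalue e i * star (falseEigenvalue e j)) fun i j =>
      mul_mem (falseEigenvalue_mem_gaussianRat e i)
        (star_mem_gaussianRat (falseEigenvalue_mem_gaussianRat e j))
  refine ⟨_, computable_geometric r μ, fun m => ?_⟩
  induction m with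
  | zero => exact hr
  | succ m ih =>
    ext i j
    have hm : ScalarCode.eval (μ i j) = falseEigenvalue e i * star (falseEigenvalue e j) :=
      congrFun (congrFun hμ i) j
    have hi : ScalarCode.eval ((ScalarCode.mul (μ i j))^[m] (r i j)) =
        matrixState e (wordUnitary (List.replicate m false ++ Q)) i j :=
      congrFun (congrFun ih i) j
    change ScalarCode.eval ((ScalarCode.mul (μ i j))^[m + 1] (r i j)) = _
    rw [Function.iterate_succ_apply', ScalarCode.eval_mul, hm, hi, List.replicate_succ,
      List.cons_append, matrixState_cons_false_apply]

theorem eval_singleton {d : ℕ} (c : MatrixCode d) :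
    ChannelCode.eval [c] = conjOp c.eval := by
  simp [ChannelCode.eval]

theorem conjOp_one {d : ℕ} : conjOp (1 : Matrix (Fin d) (Fin d) ℂ) = 1 := by
  ext1 X
  simp [conjOp_apply]

/-- The rules in `R` and the identity have a finite description. -/
theorem exists_opSetCode {d : ℕ} (e : Fin d ≃ (Fin 2 × Fin 2) ⊕ Fin (d - 4))
    {R : Set (List Bool × List Bool)} (hR : R.Finite) :
    ∃ F : OpSetCode d, F.eval = insert 1 ((fun r => conjOp (ruleOp e r)) '' R) := by
  choose c hc using fun r => exists_matrixCode (ruleOp_apply_mem_gaussianRat e r)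
  obtain ⟨i, hi⟩ := exists_matrixCode (A := (1 : Matrix (Fin d) (Fin d) ℂ)) fun i j => by
    rw [Matrix.one_apply]
    split_ifs
    exacts [one_mem _, zero_mem _]
  refine ⟨[i] :: hR.toFinset.toList.map fun r => [c r], ?_⟩
  ext Φ
  simp [OpSetCode.eval, eval_singleton, hc, hi, conjOp_one, eq_comm (a := Φ)]

/-- A decision procedure on the valid inputs decides every predicate on `ℕ` that reduces computably
to them. -/
theorem DecidableOn.computablePred {α : Type} [Primcodable α] {valid yes : α → Prop}
    (h : DecidableOn valid yes) {f : ℕ → α} (hf : Computable f) (hvalid : ∀ m, valid (f m)) :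
    ComputablePred fun m => yes (f m) := by
  obtain ⟨g, hg, hans⟩ := h
  choose b hb hyes using fun m => hans (f m) (hvalid m)
  refine ComputablePred.computable_iff.2 ⟨b, ?_, funext fun m => propext (hyes m).symm⟩
  exact (hg.comp hf).of_eq fun m => Part.eq_some_iff.2 (hb m)

theorem corollary1 (d : ℕ) (hd : 4 ≤ d) :
    ¬ DecidableOn (ReachInput.Valid (d := d)) (ReachInput.Yes (d := d)) := by
  intro hdec
  obtain ⟨R, hR, Q, T, hund⟩ := exists_binary_queue_undecidable
  let e : Fin d ≃ (Fin 2 × Fin 2) ⊕ Fin (d - 4) :=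
    Fintype.equivOfCardEq (by simp; omega)
  obtain ⟨ρ, hρ, hρ_eval⟩ := exists_computable_matrixState e Q
  obtain ⟨σ, hσ⟩ := exists_matrixCode (matrixState_apply_mem_gaussianRat e T)
  obtain ⟨F, hF⟩ := exists_opSetCode e hR
  have hcomp : Computable fun m => ((ρ m, σ, F) : ReachInput d) :=
    hρ.pair (Computable.const (σ, F))
  refine hund ?_
  convert hdec.computablePred hcomp fun m => ?_ using 2 with m
  · simp only [ReachInput.Yes, hρ_eval, hσ]
    exact (reaches_iff_exists_solvesQueue e R _ hF _ T).symm
  · refine ⟨?_, ?_, fun Φ hΦ => ?_, ?_⟩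
    · simp only [hρ_eval]
      exact isState_matrixState e (wordUnitary_mem_unitaryGroup _)
    · simp only [hσ]
      exact isState_matrixState e (wordUnitary_mem_unitaryGroup _)
    · simp only [hF] at hΦ
      rcases hΦ with rfl | ⟨r, -, rfl⟩
      · rw [← conjOp_one]
        exact isCPTP_conjOp (by simp)
      · exact isCPTP_conjOp_ruleOp e r
    · simp only [hF]
      exact Set.mem_insert _ _
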